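/- Let $X$ be a set with two Hausdorff topologies, the coarse topology and the fine topology. A set is called fine-clopen if it is both open and closed in the fine topology. Assume throughout: (D) for every infinite subset $S\subseteq X$ there is a decomposition of $X$ into disjoint fine-clopen subsets, infinitely many of which contain members of $S$ in their interiors with respect to the coarse topology. Let $G\subseteq\mathbb Z^X$ be the group of all functions $X\to\mathbb Z$ that are continuous from the fine topology to the discrete topology, and for $x\in X$ let $h_x:G\to\mathbb Z$ be evaluation at $x$. The support of $g\in G$ is $\{x\in X: g(x)\neq 0\}$. For $a\in\operatorname{Hom}(G,\mathbb Z)$ and $V\subseteq X$, say that $a$ is nonzero on $V$ if $a(g)\neq 0$ for some $g\in G$ with support contained in $V$. Say that $a$ is nonzero near $x\in X$ if it is nonzero on every neighborhood of $x$ in the coarse topology. A cardinal $\kappa$ is called measurable if it is uncountable and a set of cardinality $\kappa$ carries a nonprincipal ultrafilter closed under intersections of fewer than $\kappa$ members. **I.** Assume (D), that the coarse topology is compact, that $|X|$ is less than every measurable cardinal (if any exist), and that for every $x\in X$ there is a family $(W_i)_{i\in I_x}$ of pairwise disjoint fine-clopen sets with $X-\{x\}=\bigcup_{i\in I_x}W_i$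 such that $x$ has a basis of neighborhoods in the coarse topology consisting of sets that are coarse-open, fine-clopen, and of the form $\{x\}\cup\bigcup_{i\in J}W_i$ with $J\subseteq I_x$. Then: 1. The homomorphisms $h_x$ $(x\in X)$ are linearly independent. 2. If $a\in\operatorname{Hom}(G,\mathbb Z)$ is nonzero, then $a$ is nonzero near some $x\in X$. 3. Let $X=\bigcup_{i\in I}U_i$, where the $U_i$ are pairwise disjoint fine-clopen sets and $I$ is an arbitrary (not necessarily countable) index set, and let $a\in\operatorname{Hom}(G,\mathbb Z)$. Then $a$ is nonzero on $U_i$ for only finitely many $i\in I$. If $U$ is the union of these finitely many $U_i$, then the value of $a$ at every $g\in G$ is determined by the restriction of $g$ to $U$; equivalently, $a(g)=0$ for all $g\in G$ with support in $X-U$. 4. For every $a\in\operatorname{Hom}(G,\mathbb Z)$ there are only finitely many $x\in X$ such that $a$ is nonzero near $x$. 5. Every $a\in\operatorname{Hom}(G,\mathbb Z)$ can be written $a=a_1+\dots+a_n$ $(n\ge 0)$, with $a_m\in\operatorname{Hom}(G,\mathbb Z)$, where for each $m$ there is a unique point $x_m\in X$ such that $a_m$ is nonzero near $x_m$. Moreover,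 for any $a\in\operatorname{Hom}(G,\mathbb Z)$ and $x\in X$, the point $x$ is the unique point near which $a$ is nonzero if and only if $a\neq 0$ and $a$ annihilates all $g\in G$ whose supports do not have $x$ in their closure in the coarse topology. 6. If $x$ is the unique point of $X$ near which $a\in\operatorname{Hom}(G,\mathbb Z)$ is nonzero, then $a$ is an integer multiple of $h_x$. 7. $\operatorname{Hom}(G,\mathbb Z)$ is the free abelian group on the evaluation maps $h_x$ $(x\in X)$. **II.** Assume (D), that the coarse topology is compact and first-countable, and that the coarse topology has a basis of open sets that are fine-clopen. Then statement 3 holds, again for an arbitrary index set $I$. -/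

import Mathlib

open Topology

universe u v

namespace TwoTopologies

/-- A measurable cardinal: an uncountable cardinal `κ` such that a set of cardinality `κ`
carries a nonprincipal `κ`-complete ultrafilter (one closed under intersections of
fewer than `κ` members). -/
def IsMeasurableCardinal (κ : Cardinal.{u}) : Prop :=
  Cardinal.aleph0 < κ ∧
    ∃ F : Ultrafilter κ.out,
      CardinalInterFilter (F : Filter κ.out) κ ∧ ∀ x : κ.out, F ≠ pure x

variable {X : Type u}

/-- `U` is a family of pairwise disjoint sets, clopen in the topology `tf`, with union `Y`. -/
def IsClopenDecomposition (tf : TopologicalSpace X) {I : Type v} (U : I → Set X) (Y : Set X) :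
    Prop :=
  (∀ i, @IsClopen X tf (U i)) ∧ (∀ i j, i ≠ j → Disjoint (U i) (U j)) ∧ ⋃ i, U i = Y

/-- The coarse topology `tc` has a basis of open sets that are clopen in the fine
topology `tf`. -/
def HasFineClopenBasis (tc tf : TopologicalSpace X) : Prop :=
  ∃ B : Set (Set X), @TopologicalSpace.IsTopologicalBasis X tc B ∧ ∀ V ∈ B, @IsClopen X tf V

/-- For every infinite `S` there is a decomposition of `X` into disjoint fine-clopen subsets,
infinitely many of which contain members of `S` in their coarse interiors. -/
def HasSeparatingDecompositions (tc tf : TopologicalSpace X) : Prop :=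
  ∀ S : Set X, S.Infinite →
    ∃ (I : Type u) (U : I → Set X), IsClopenDecomposition tf U Set.univ ∧
      {i : I | (S ∩ @interior X tc (U i)).Nonempty}.Infinite

/-- For every `x` there is a decomposition of `X - {x}` into disjoint fine-clopen sets `W i`
such that `x` has a basis of coarse-open neighbourhoods that are fine-clopen and are the union
of `{x}` with some of the `W i`. -/
def HasPointwiseDecompositions (tc tf : TopologicalSpace X) : Prop :=
  ∀ x : X, ∃ (I : Type u) (W : I → Set X), IsClopenDecomposition tf W {x}ᶜ ∧
    ∀ N ∈ @nhds X tc x, ∃ J : Set I,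
      IsOpen[tc] ({x} ∪ ⋃ i ∈ J, W i) ∧ @IsClopen X tf ({x} ∪ ⋃ i ∈ J, W i) ∧
        {x} ∪ ⋃ i ∈ J, W i ⊆ N

/-- The group of all functions `X → ℤ` that are continuous from the topology `tf` to the
discrete topology. -/
def contGroup (tf : TopologicalSpace X) : AddSubgroup (X → ℤ) where
  carrier := {g | Continuous[tf, ⊥] g}
  zero_mem' := by
    exact @continuous_const X ℤ tf ⊥ 0
  add_mem' := by
    intro f g hf hg
    rw [Set.mem_ofPred_eq, ← DiscreteTopology.eq_bot (α := ℤ)] at *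
    exact hf.add hg
  neg_mem' := by
    intro f hf
    rw [Set.mem_ofPred_eq, ← DiscreteTopology.eq_bot (α := ℤ)] at *
    exact hf.neg

/-- Evaluation at `x`, as a homomorphism on the group of continuous functions. -/
def evalHom (tf : TopologicalSpace X) (x : X) : contGroup tf →+ ℤ where
  toFun g := g.1 x
  map_zero' := rfl
  map_add' _ _ := rfl

/-- There is an element of the group with support in `U` on which `a` has nonzero value. -/
def NonzeroOn {tf : TopologicalSpace X} (a : contGroup tf →+ ℤ) (U : Set X) : Prop :=
  ∃ g : contGroup tf, Function.support g.1 ⊆ U ∧ a g ≠ 0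

/-- For every coarse neighbourhood `U` of `x`, there is an element of the group with support
in `U` on which `a` has nonzero value. -/
def NonzeroNear (tc : TopologicalSpace X) {tf : TopologicalSpace X} (a : contGroup tf →+ ℤ)
    (x : X) : Prop :=
  ∀ U ∈ @nhds X tc x, NonzeroOn a U

/-- `x` is the unique point such that `a` is nonzero near `x`. -/
def UniquelyNonzeroNear (tc : TopologicalSpace X) {tf : TopologicalSpace X}
    (a : contGroup tf →+ ℤ) (x : X) : Prop :=
  NonzeroNear tc a x ∧ ∀ y, NonzeroNear tc a y → y = x

/-- Only finitely many `U i` support elements of the group on which `a` is nonzero; the value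
of `a` at every `g` is determined by the restriction of `g` to the union of these `U i`; and
`a` vanishes on every `g` with support in the complement of that union. -/
def FinitelyDetermined {tf : TopologicalSpace X} (a : contGroup tf →+ ℤ) {I : Type v}
    (U : I → Set X) : Prop :=
  {i | NonzeroOn a (U i)}.Finite ∧
  (∀ g g' : contGroup tf, (∀ i, NonzeroOn a (U i) → ∀ x ∈ U i, g.1 x = g'.1 x) → a g = a g') ∧
  (∀ g : contGroup tf,
    Function.support g.1 ⊆ (⋃ i ∈ {i | NonzeroOn a (U i)}, U i)ᶜ → a g = 0)

end TwoTopologies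

open TwoTopologies

/-! If `g` in the group lives on disjoint fine-clopen pieces, multiplying it by an independent
integer on each piece stays in the group (`weave`). A homomorphism `a` thus induces homomorphisms on
powers of ℤ, to which Specker's arguments apply: only finitely many unit vectors have nonzero image.
By `CountablyCompletePrincipal.map_eq_zero`, if every countably complete ultrafilter on the index
set is principal, a homomorphism killing the unit vectors is zero. The pieces can be indexed by
points of X, so this is needed only for X: it follows from the bound on |X|, or from coarse
compactness with first countability.

This gives statement 3 (`IsClopenDecomposition.finitelyDetermined`). Compactness yields a point near
which a nonzero `a` is nonzero, (D) leaves finitely many such points, and restricting to disjoint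
neighbourhoods splits `a`. If x is the only such point and g(x) = 0, cutting g along the `W i` gives
a(g) = 0; hence a = a(1) h_x. -/

namespace TwoTopologies
variable {X : Type u}
-- Homomorphisms from powers of ℤ to ℤ
section Specker

/-- The homomorphism sending `c` to the function `x ↦ c (r x) * f x`. -/
def weave {Y : Type*} {I : Type*} (r : Y → I) (f : Y → ℤ) : (I → ℤ) →+ (Y → ℤ) where
  toFun c y := c (r y) * f y
  map_zero' := by ext; simp
  map_add' c d := by ext; simp [add_mul]

theorem weave_apply {Y : Type*} {I : Type*} (r : Y → I) (f : Y → ℤ) (c : I → ℤ) (y : Y) :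
    weave r f c y = c (r y) * f y := rfl

theorem weave_one {Y : Type*} {I : Type*} (r : Y → I) (f : Y → ℤ) : weave r f 1 = f := by
  ext; simp [weave_apply]

theorem weave_single {Y : Type*} {I : Type*} [DecidableEq I] (r : Y → I) (f : Y → ℤ) (i : I) :
    weave r f (Pi.single i 1) = (r ⁻¹' {i}).indicator f := by
  ext y
  by_cases h : r y = i
  · simp [weave_apply, Set.indicator, h]
  · simp [weave_apply, Set.indicator, h]

/-- The tail of `u` from `n` on is `d` times another sequence. -/
theorem dvd_map_sub_sum (φ : (ℕ → ℤ) →+ ℤ) (n : ℕ) (d : ℤ) (u : ℕ → ℤ)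
    (h : ∀ k, n ≤ k → d ∣ u k) :
    d ∣ φ u - ∑ k ∈ Finset.range n, u k * φ (Pi.single k 1) := by
  choose! w hw using h
  have hu : u = ∑ k ∈ Finset.range n, u k • (Pi.single k 1 : ℕ → ℤ)
      + d • fun k => if n ≤ k then w k else 0 := by
    ext k
    simp only [Pi.add_apply, Finset.sum_apply, Pi.smul_apply, Pi.single_apply, smul_eq_mul,
      mul_ite, mul_one, mul_zero, Finset.sum_ite_eq, Finset.mem_range]
    by_cases hk : n ≤ k
    · simp [hk, hw k hk]
    · simp [hk, not_le.mp hk]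
  have := congrArg φ hu
  rw [map_add, map_sum, map_zsmul] at this
  simp only [map_zsmul, smul_eq_mul] at this
  exact ⟨_, by rw [this, add_sub_cancel_left]⟩

/-- Uncountably many 0-1 choices of the terms `d n` cannot all have different images in ℤ. At the
first place `n` where two choices with equal image differ, `d (n + 1)` divides `d n * b n`, so `|b
n| + 1` divides `b n`. -/
theorem exists_map_single_eq_zero (φ : (ℕ → ℤ) →+ ℤ) : ∃ n, φ (Pi.single n 1) = 0 := by
  by_contra! hb
  set b : ℕ → ℤ := fun n => φ (Pi.single n 1) with hbdef
  set d : ℕ → ℤ := fun n => ∏ k ∈ Finset.range n, (|b k| + 1) with hd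
  have hpos : ∀ n, d n ≠ 0 := fun n => Finset.prod_ne_zero_iff.mpr fun k _ => by positivity
  have hdvd : ∀ m n, m ≤ n → d m ∣ d n := fun m n hmn =>
    Finset.prod_dvd_prod_of_subset _ _ _ (Finset.range_mono hmn)
  have hsucc : ∀ n, d (n + 1) = d n * (|b n| + 1) := fun n => Finset.prod_range_succ _ _
  have hninj : ¬ Function.Injective
      (fun ε : ℕ → Bool => φ (fun n => if ε n then d n else 0)) := by
    intro hinj
    obtain ⟨f, hf⟩ := hinj.countable.exists_injective_nat
    classical
    refine Function.cantor_injective (fun s : Set ℕ => f fun n => decide (n ∈ s)) fun s t hst => ?_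
    ext n
    simpa using congrFun (hf hst) n
  simp only [Function.Injective, not_forall] at hninj
  obtain ⟨ε, ε', heq, hne⟩ := hninj
  have hex : ∃ n, ε n ≠ ε' n := Function.ne_iff.mp hne
  classical
  let n := Nat.find hex
  have hn : ε n ≠ ε' n := Nat.find_spec hex
  have hlt : ∀ k < n, ε k = ε' k := fun k hk => not_not.mp (Nat.find_min hex hk)
  let v : ℕ → ℤ := (fun n => if ε n then d n else 0) - (fun n => if ε' n then d n else 0)
  have hv0 : φ v = 0 := by rw [map_sub, heq, sub_self]
  have h1 := dvd_map_sub_sum φ (n + 1) (d (n + 1)) v (by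
    intro k hk
    refine dvd_sub ?_ ?_
    · dsimp only; split_ifs
      exacts [hdvd _ _ hk, dvd_zero _]
    · dsimp only; split_ifs
      exacts [hdvd _ _ hk, dvd_zero _])
  rw [hv0, zero_sub, dvd_neg, Finset.sum_range_succ, Finset.sum_eq_zero, zero_add] at h1
  · have h2 : d (n + 1) ∣ d n * b n := by
      cases h : ε n <;> cases h' : ε' n <;> simp [h, h', v] at h1 hn <;> exact h1
    rw [hsucc] at h2
    have h3 := (mul_dvd_mul_iff_left (hpos n)).mp h2
    exact hb n (Int.eq_zero_of_abs_lt_dvd h3 (lt_add_one _))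
  · intro k hk
    simp [v, hlt k (Finset.mem_range.mp hk)]

/-- A homomorphism `ℤ ^ I → ℤ` is nonzero on only finitely many of the unit vectors. -/
theorem finite_map_single_ne_zero {I : Type*} [DecidableEq I] (φ : (I → ℤ) →+ ℤ) :
    {i | φ (Pi.single i 1) ≠ 0}.Finite := by
  by_contra hinf
  let e := Set.Infinite.natEmbedding _ hinf
  have he : Function.Injective fun n => (e n : I) :=
    fun m n h => e.injective (Subtype.ext h)
  have hinv : ∀ n, Function.invFun (fun n => (e n : I)) (e n) = n :=
    Function.leftInverse_invFun he
  obtain ⟨n, hn⟩ := exists_map_single_eq_zero (φ.comp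
    (weave (Function.invFun fun n => (e n : I)) ((Set.range fun n => (e n : I)).indicator 1)))
  refine (e n).2 ?_
  rw [AddMonoidHom.comp_apply, weave_single] at hn
  convert hn using 2
  ext i
  by_cases hi : i ∈ Set.range fun n => (e n : I)
  · obtain ⟨m, rfl⟩ := hi
    by_cases hmn : m = n
    · subst hmn; simp [Set.indicator, hinv]
    · have : (e m : I) ≠ e n := fun h => hmn (he h)
      simp [Set.indicator, hinv, hmn, this]
  · have : i ≠ e n := fun h => hi ⟨n, h.symm⟩
    rw [Pi.single_eq_of_ne this]
    simp only [Set.indicator, hi, if_false, ite_self]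

/-- A homomorphism `ℤ ^ ℕ → ℤ` that kills the unit vectors is zero. -/
theorem map_eq_zero_of_map_single (φ : (ℕ → ℤ) →+ ℤ) (h : ∀ n, φ (Pi.single n 1) = 0)
    (u : ℕ → ℤ) : φ u = 0 := by
  -- Such a value is divisible by every power of `p`. Since `2 ^ n` and `3 ^ n` are coprime, every
  -- sequence is a sum of one of these for `p = 2` and one for `p = 3`.
  have key : ∀ (p : ℤ), 2 ≤ p → ∀ w : ℕ → ℤ, φ (fun n => p ^ n * w n) = 0 := by
    intro p hp w
    obtain ⟨N, hN⟩ := exists_nat_gt |φ (fun n => p ^ n * w n)|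
    have h1 := dvd_map_sub_sum φ N (p ^ N) (fun n => p ^ n * w n)
      fun k hk => (pow_dvd_pow p hk).mul_right _
    simp only [h, mul_zero, Finset.sum_const_zero, sub_zero] at h1
    refine Int.eq_zero_of_abs_lt_dvd h1 (hN.trans ?_)
    calc ((N : ℕ) : ℤ) < 2 ^ N := by exact_mod_cast Nat.lt_two_pow_self
      _ ≤ p ^ N := pow_le_pow_left₀ (by norm_num) hp N
  have hcop : ∀ n : ℕ, ∃ s t : ℤ, s * 2 ^ n + t * 3 ^ n = 1 := fun n =>
    IsCoprime.pow (R := ℤ) (Int.isCoprime_iff_gcd_eq_one.mpr (by norm_num))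
  choose s t hst using hcop
  have hu : u = (fun n => 2 ^ n * (s n * u n)) + fun n => 3 ^ n * (t n * u n) := by
    ext n
    simp only [Pi.add_apply]
    linear_combination (-u n) * hst n
  rw [hu, map_add, key 2 le_rfl, key 3 (by norm_num), add_zero]

end Specker

/-! ### Null sets and countably complete ultrafilters -/

section Ultrafilters

/-- Every countably complete ultrafilter on `Y` is principal. -/
def CountablyCompletePrincipal (Y : Type*) : Prop :=
  ∀ F : Ultrafilter Y, CountableInterFilter (F : Filter Y) → ∃ y, F = pure y

/-- The homomorphism `φ` kills all functions supported in `B`. -/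
def IsNull {Y : Type*} (φ : (Y → ℤ) →+ ℤ) (B : Set Y) : Prop :=
  ∀ c : Y → ℤ, Function.support c ⊆ B → φ c = 0

theorem IsNull.mono {Y : Type*} {φ : (Y → ℤ) →+ ℤ} {A B : Set Y} (hB : IsNull φ B)
    (h : A ⊆ B) : IsNull φ A := fun c hc => hB c (hc.trans h)

/-- Sorting the support of `c` into the `B n` gives a homomorphism on ℤ^ℕ that kills the unit
vectors and sends 1 to `φ c`. -/
theorem IsNull.iUnion {Y : Type*} {φ : (Y → ℤ) →+ ℤ} {B : ℕ → Set Y}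
    (hB : ∀ n, IsNull φ (B n)) : IsNull φ (⋃ n, B n) := by
  intro c hc
  have hr : ∀ y, ∃ n, c y ≠ 0 → y ∈ B n := by
    intro y
    by_cases hy : c y = 0
    · exact ⟨0, fun h => absurd hy h⟩
    · obtain ⟨n, hn⟩ := Set.mem_iUnion.mp (hc hy)
      exact ⟨n, fun _ => hn⟩
  choose r hr using hr
  have := map_eq_zero_of_map_single (φ.comp (weave r c)) (fun n => by
    rw [AddMonoidHom.comp_apply, weave_single]
    refine hB n _ fun y hy => ?_
    rw [Set.support_indicator] at hy
    obtain ⟨rfl, h⟩ := hy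
    exact hr y h) 1
  rwa [AddMonoidHom.comp_apply, weave_one] at this

theorem IsNull.union {Y : Type*} {φ : (Y → ℤ) →+ ℤ} {A B : Set Y}
    (hA : IsNull φ A) (hB : IsNull φ B) : IsNull φ (A ∪ B) := by
  refine (IsNull.iUnion (B := fun n => if n = 0 then A else B) fun n => ?_).mono ?_
  · split_ifs <;> assumption
  · rintro y (h | h)
    · exact Set.mem_iUnion.mpr ⟨0, by simpa⟩
    · exact Set.mem_iUnion.mpr ⟨1, by simpa⟩

theorem exists_isNull_of_disjoint {Y : Type*} (φ : (Y → ℤ) →+ ℤ) (C : ℕ → Set Y)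
    (hC : ∀ m n, m ≠ n → Disjoint (C m) (C n)) : ∃ n, IsNull φ (C n) := by
  classical
  by_contra! h
  simp only [IsNull, not_forall, exists_prop] at h
  choose c hc hφ using h
  -- The default 0 is harmless: outside all `C n` the woven function is `c 0`, which vanishes there.
  let r : Y → ℕ := fun y => if h : ∃ n, y ∈ C n then h.choose else 0
  have hr : ∀ n, ∀ y ∈ C n, r y = n := by
    intro n y hy
    have hex : ∃ n, y ∈ C n := ⟨n, hy⟩
    by_contra hne
    have h1 : r y = hex.choose := dif_pos hex
    exact Set.disjoint_left.mp (hC _ _ hne) (h1 ▸ hex.choose_spec) hy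
  obtain ⟨n, hn⟩ := exists_map_single_eq_zero (φ.comp (weave r fun y => c (r y) y))
  refine hφ n ?_
  rw [AddMonoidHom.comp_apply, weave_single] at hn
  convert hn using 2
  ext y
  by_cases hy : r y = n
  · simp [Set.indicator, hy]
  · have : c n y = 0 := by
      by_contra h0
      exact hy (hr n y (hc n h0))
    simp [Set.indicator, hy, this]

/-- Every non-null set contains a non-null set that cannot be split into two non-null sets. -/
theorem exists_indecomposable {Y : Type*} (φ : (Y → ℤ) →+ ℤ) (h : ¬ IsNull φ Set.univ) :
    ∃ A, ¬ IsNull φ A ∧ ∀ B, IsNull φ (A ∩ B) ∨ IsNull φ (A \ B) := by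
  by_contra! hsplit
  choose! S hS using hsplit
  -- Splitting forever would leave infinitely many disjoint non-null differences.
  let T : ℕ → {A // ¬ IsNull φ A} := fun n =>
    (fun A : {A // ¬ IsNull φ A} => ⟨A.1 ∩ S A.1, (hS A.1 A.2).1⟩)^[n] ⟨Set.univ, h⟩
  have hT : ∀ n, (T (n + 1)).1 = (T n).1 ∩ S (T n).1 := fun n => by
    simp only [T, Function.iterate_succ_apply']
  have hanti : Antitone fun n => (T n).1 :=
    antitone_nat_of_succ_le fun n => by rw [hT]; exact Set.inter_subset_left
  have hdis : ∀ m n, m < n → Disjoint ((T m).1 \ (T (m + 1)).1) ((T n).1 \ (T (n + 1)).1) := by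
    intro m n hmn
    exact Set.disjoint_left.mpr fun y hy hy' => hy.2 (hanti (Nat.succ_le_of_lt hmn) hy'.1)
  obtain ⟨n, hn⟩ := exists_isNull_of_disjoint φ (fun n => (T n).1 \ (T (n + 1)).1) (by
    intro m n hmn
    rcases lt_or_gt_of_ne hmn with h | h
    exacts [hdis m n h, (hdis n m h).symm])
  refine (hS _ (T n).2).2 ?_
  rwa [hT, Set.sdiff_self_inter] at hn

/-- If all countably complete ultrafilters on `Y` are principal, then a homomorphism `ℤ ^ Y → ℤ`
that kills the unit vectors is zero. -/
theorem CountablyCompletePrincipal.map_eq_zero {Y : Type*} [DecidableEq Y]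
    (hY : CountablyCompletePrincipal Y)
    (φ : (Y → ℤ) →+ ℤ) (h : ∀ y, φ (Pi.single y 1) = 0) (c : Y → ℤ) : φ c = 0 := by
  by_contra hc
  obtain ⟨A, hA, hsplit⟩ := exists_indecomposable φ fun hn => hc (hn c (Set.subset_univ _))
  -- Indecomposability of `A` makes this an ultrafilter, and `IsNull.iUnion` makes it countably
  -- complete. If it is principal at `y`, then `A` is null up to `y`, and `{y}` is null as well.
  let F : Filter Y :=
    { sets := {B | IsNull φ (A \ B)}
      univ_sets := fun c hc => by
        have : c = 0 := by simpa [Set.sdiff_univ] using hc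
        rw [this, map_zero]
      sets_of_superset := fun hB hBC => hB.mono (Set.sdiff_subset_sdiff_right hBC)
      inter_sets := fun hB hC => by
        have := hB.union hC
        rwa [← Set.sdiff_inter] at this }
  have hF : ∀ B, B ∈ F ↔ IsNull φ (A \ B) := fun B => Iff.rfl
  have hne : ∀ B, Bᶜ ∉ F ↔ B ∈ F := by
    intro B
    rw [hF, hF, Set.sdiff_compl]
    refine ⟨fun hB => (hsplit B).resolve_left hB, fun hB hB' => hA ?_⟩
    have := hB'.union hB
    rwa [Set.inter_union_sdiff] at this
  let U := Ultrafilter.ofComplNotMemIff F hne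
  have hU : ∀ B, B ∈ U ↔ IsNull φ (A \ B) := fun B => Iff.rfl
  obtain ⟨y, hy⟩ := hY U ⟨by
    intro S hS hSU
    change IsNull φ (A \ ⋂₀ S)
    rcases S.eq_empty_or_nonempty with rfl | hne
    · rw [Set.sInter_empty]; exact (hU _).mp Filter.univ_mem
    obtain ⟨f, rfl⟩ := hS.exists_eq_range hne
    refine (IsNull.iUnion (B := fun n => A \ f n) fun n => hSU _ ⟨n, rfl⟩).mono ?_
    rw [Set.sInter_range, Set.sdiff_iInter]⟩
  have h1 : IsNull φ (A \ {y}) := (hU _).mp (by rw [hy]; exact Ultrafilter.mem_pure.mpr rfl)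
  refine hA ((h1.union (B := {y}) ?_).mono fun z hz => ?_)
  · intro c hc
    have : c = c y • Pi.single y 1 := by
      ext z
      by_cases hz : z = y
      · subst hz; simp
      · have : c z = 0 := by
          by_contra h0
          exact hz (hc h0)
        simp [hz, this]
    rw [this, map_zsmul, h, smul_zero]
  · by_cases hzy : z = y
    · exact Or.inr hzy
    · exact Or.inl ⟨hz, hzy⟩

/-- For a nonprincipal `F`, let κ be the least number of members whose intersection is not in `F`;
complements of points show κ ≤ |X|. Sending each point to a member that misses it pushes `F` to a
nonprincipal κ-complete ultrafilter on κ, so κ is measurable. -/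
theorem countablyCompletePrincipal_of_lt_measurable
    (h : ∀ κ : Cardinal.{u}, IsMeasurableCardinal κ → Cardinal.mk X < κ) :
    CountablyCompletePrincipal X := by
  intro F hF
  by_contra! hne
  have hsingle : ∀ x, {x}ᶜ ∈ F := by
    intro x
    rw [Ultrafilter.compl_mem_iff_notMem]
    intro hx
    refine hne x (Ultrafilter.eq_of_le ?_)
    rw [Ultrafilter.coe_pure, Filter.le_pure_iff]
    exact hx
  let P : Cardinal.{u} → Prop := fun κ =>
    ∃ S : Set (Set X), Cardinal.mk S = κ ∧ (∀ s ∈ S, s ∈ F) ∧ ⋂₀ S ∉ F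
  have hP : P (Cardinal.mk (Set.range fun x : X => ({x}ᶜ : Set X))) := by
    refine ⟨_, rfl, ?_, ?_⟩
    · rintro _ ⟨x, rfl⟩; exact hsingle x
    · have : ⋂₀ (Set.range fun x : X => ({x}ᶜ : Set X)) = ∅ := by
        ext y; simp
      rw [this]; exact F.empty_notMem
  set κ := sInf {κ | P κ} with hκ
  have hκP : P κ := csInf_mem (s := {κ | P κ}) ⟨_, hP⟩
  have hmin : ∀ S : Set (Set X), Cardinal.mk S < κ → (∀ s ∈ S, s ∈ F) → ⋂₀ S ∈ F := by
    intro S hS hSF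
    by_contra hS'
    exact notMem_of_lt_csInf' (s := {κ | P κ}) hS ⟨S, rfl, hSF, hS'⟩
  have hle : κ ≤ Cardinal.mk X := (csInf_le' (s := {κ | P κ}) hP).trans Cardinal.mk_range_le
  obtain ⟨S, hSκ, hSF, hSint⟩ := hκP
  refine absurd (h κ ⟨?_, ?_⟩) hle.not_gt
  · by_contra! hc
    rw [← hSκ, Cardinal.le_aleph0_iff_set_countable] at hc
    exact hSint ((countable_sInter_mem hc).mpr hSF)
  · obtain ⟨e⟩ : Nonempty (S ≃ κ.out) := Cardinal.eq.mp (hSκ.trans (Cardinal.mk_out κ).symm)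
    have hSne : Nonempty S := by
      by_contra hemp
      rw [not_nonempty_iff, Set.isEmpty_coe_sort] at hemp
      rw [hemp, Set.sInter_empty] at hSint
      exact hSint Filter.univ_mem
    have hf : ∀ x, ∃ s : S, x ∉ ⋂₀ S → x ∉ s.1 := by
      intro x
      by_cases hx : x ∈ ⋂₀ S
      · exact ⟨hSne.some, fun h => absurd hx h⟩
      · simp only [Set.mem_sInter, not_forall] at hx
        obtain ⟨s, hs, hxs⟩ := hx
        exact ⟨⟨s, hs⟩, fun _ => hxs⟩
    choose f hf using hf
    refine ⟨F.map (e ∘ f), ⟨?_⟩, ?_⟩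
    · intro T hT hTF
      change (e ∘ f) ⁻¹' ⋂₀ T ∈ F
      have : (e ∘ f) ⁻¹' ⋂₀ T = ⋂₀ ((fun t => (e ∘ f) ⁻¹' t) '' T) := by
        rw [Set.sInter_image, Set.preimage_sInter]
      rw [this]
      refine hmin _ (Cardinal.mk_image_le.trans_lt hT) ?_
      rintro _ ⟨t, ht, rfl⟩
      exact hTF t ht
    · intro y hy
      have h1 : {y} ∈ F.map (e ∘ f) := by rw [hy]; exact Ultrafilter.mem_pure.mpr rfl
      have h2 : (e ∘ f) ⁻¹' {y} ∈ F := h1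
      have h3 : (⋂₀ S)ᶜ ∈ F := Ultrafilter.compl_mem_iff_notMem.mpr hSint
      have h4 : (e.symm y).1 ∈ F := hSF _ (e.symm y).2
      obtain ⟨x, ⟨hx1, hx2⟩, hx3⟩ := F.nonempty_of_mem
        (Filter.inter_mem (Filter.inter_mem h2 h3) h4)
      have h5 : f x = e.symm y := by rw [Equiv.eq_symm_apply]; exact hx1
      exact hf x hx2 (h5 ▸ hx3)

/-- The ultrafilter converges to some `x`, so it contains the intersection of a countable
neighbourhood basis, which is `{x}`. -/
theorem countablyCompletePrincipal_of_compact_firstCountable [TopologicalSpace X] [T2Space X]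
    [CompactSpace X] [FirstCountableTopology X] : CountablyCompletePrincipal X := by
  intro F hF
  obtain ⟨x, hx⟩ : ∃ x, (F : Filter X) ≤ 𝓝 x := ⟨_, F.le_nhds_lim⟩
  refine ⟨x, Ultrafilter.eq_of_le ?_⟩
  obtain ⟨B, hB⟩ := (𝓝 x).exists_antitone_basis
  rw [Ultrafilter.coe_pure, Filter.le_pure_iff]
  refine Filter.mem_of_superset
    (countable_iInter_mem.mpr fun n => hx (hB.1.mem_of_mem (i := n) trivial)) ?_
  intro y hy
  by_contra hyx
  obtain ⟨n, -, hn⟩ := hB.1.mem_iff.mp (isOpen_compl_singleton.mem_nhds (Ne.symm hyx : x ≠ y))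
  exact hn (Set.mem_iInter.mp hy n) rfl

end Ultrafilters

/-! ### Gluing and restricting along fine-clopen sets -/

theorem mem_contGroup_iff {tf : TopologicalSpace X} {g : X → ℤ} :
    g ∈ contGroup tf ↔ ∀ x, ∀ᶠ y in @nhds X tf x, g y = g x := by
  rw [← @IsLocallyConstant.iff_eventually_eq X ℤ tf g]
  change Continuous[tf, ⊥] g ↔ _
  rw [continuous_def]
  exact ⟨fun h s => h s trivial, fun h s _ => h s⟩

theorem weave_mem_contGroup {tf : TopologicalSpace X} {I : Type*} {r : X → I} {f : X → ℤ}
    (h : ∀ x, (∀ᶠ y in @nhds X tf x, r y = r x ∧ f y = f x) ∨ ∀ᶠ y in @nhds X tf x, f y = 0)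
    (c : I → ℤ) : weave r f c ∈ contGroup tf := by
  rw [mem_contGroup_iff]
  intro x
  rcases h x with h | h
  · filter_upwards [h] with y hy
    simp [weave_apply, hy]
  · have hx : f x = 0 := h.self_of_nhds
    filter_upwards [h] with y hy
    simp [weave_apply, hy, hx]

/-- Restriction to a clopen set, extended by zero. -/
noncomputable def restrict {tf : TopologicalSpace X} {V : Set X} (hV : @IsClopen X tf V) :
    contGroup tf →+ contGroup tf where
  toFun g := ⟨V.indicator g.1, mem_contGroup_iff.mpr fun x => by
    have hg := mem_contGroup_iff.mp g.2 x
    by_cases hx : x ∈ V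
    · filter_upwards [hg, hV.isOpen.mem_nhds hx] with y hy hyV
      rw [Set.indicator_of_mem hyV, Set.indicator_of_mem hx, hy]
    · filter_upwards [hV.compl.isOpen.mem_nhds hx] with y hyV
      rw [Set.indicator_of_notMem hyV, Set.indicator_of_notMem hx]⟩
  map_zero' := by ext; simp
  map_add' g g' := Subtype.ext (Set.indicator_add V g.1 g'.1)

theorem restrict_coe {tf : TopologicalSpace X} {V : Set X} (hV : @IsClopen X tf V)
    (g : contGroup tf) : (restrict hV g).1 = V.indicator g.1 := rfl

theorem support_restrict {tf : TopologicalSpace X} {V : Set X} (hV : @IsClopen X tf V)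
    (g : contGroup tf) : Function.support (restrict hV g).1 = V ∩ Function.support g.1 :=
  Set.support_indicator

theorem restrict_add_restrict_compl {tf : TopologicalSpace X} {V : Set X}
    (hV : @IsClopen X tf V) (g : contGroup tf) : restrict hV g + restrict hV.compl g = g :=
  Subtype.ext (Set.indicator_self_add_compl V g.1)

theorem NonzeroOn.mono {tf : TopologicalSpace X} {a : contGroup tf →+ ℤ} {U V : Set X}
    (h : NonzeroOn a U) (hUV : U ⊆ V) : NonzeroOn a V :=
  let ⟨g, hg, ha⟩ := h
  ⟨g, hg.trans hUV, ha⟩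

theorem map_eq_zero_of_not_nonzeroOn {tf : TopologicalSpace X} {a : contGroup tf →+ ℤ}
    {U : Set X} (h : ¬ NonzeroOn a U) {g : contGroup tf} (hg : Function.support g.1 ⊆ U) :
    a g = 0 := by
  by_contra h0
  exact h ⟨g, hg, h0⟩

theorem not_nonzeroOn_union {tf : TopologicalSpace X} {a : contGroup tf →+ ℤ} {U V : Set X}
    (hU : @IsClopen X tf U) (h : ¬ NonzeroOn a U) (h' : ¬ NonzeroOn a V) :
    ¬ NonzeroOn a (U ∪ V) := by
  rintro ⟨g, hg, ha⟩
  rw [← restrict_add_restrict_compl hU g, map_add, map_eq_zero_of_not_nonzeroOn h,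
    map_eq_zero_of_not_nonzeroOn h', add_zero] at ha
  · exact ha rfl
  · rw [support_restrict]
    rintro x ⟨hx, hx'⟩
    exact (hg hx').resolve_left hx
  · rw [support_restrict]; exact Set.inter_subset_left

/-- If `g` vanishes off the union of disjoint clopen sets `W i` and `a` kills all its restrictions
to these sets, then `a` kills `g`. -/
theorem map_eq_zero_of_restrict {tf : TopologicalSpace X} (hX : CountablyCompletePrincipal X)
    {I : Type*} {W : I → Set X} (hW : ∀ i, @IsClopen X tf (W i))
    (hdis : ∀ i j, i ≠ j → Disjoint (W i) (W j)) (a : contGroup tf →+ ℤ) (g : contGroup tf)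
    (hg : ∀ x, (∃ i, x ∈ W i) ∨ g.1 x = 0) (ha : ∀ i, a (restrict (hW i) g) = 0) : a g = 0 := by
  classical
  have huniq : ∀ {i j x}, x ∈ W i → x ∈ W j → i = j := fun {i j x} hi hj => by
    by_contra h
    exact Set.disjoint_left.mp (hdis i j h) hi hj
  -- Each piece is named by one of its own points, so coefficients are indexed by X and `hX` serves
  -- for every `I`.
  have hr : ∃ r : X → X, (∀ i, ∀ x ∈ W i, r x ∈ W i) ∧ ∀ i, ∀ x ∈ W i, ∀ y ∈ W i, r x = r y := by
    refine ⟨fun x => if h : ∃ i, x ∈ W i then Set.Nonempty.some (s := W h.choose) ⟨x, h.choose_spec⟩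
      else x, ?_, ?_⟩
    · intro i x hx
      have h : ∃ i, x ∈ W i := ⟨i, hx⟩
      dsimp only
      rw [dif_pos h]
      have := huniq hx h.choose_spec
      rw [this]
      exact Set.Nonempty.some_mem _
    · intro i x hx y hy
      have h : ∃ i, x ∈ W i := ⟨i, hx⟩
      have h' : ∃ i, y ∈ W i := ⟨i, hy⟩
      have e : h.choose = h'.choose := (huniq hx h.choose_spec).symm.trans (huniq hy h'.choose_spec)
      dsimp only
      rw [dif_pos h, dif_pos h']
      congr 1
      rw [e]
  obtain ⟨r, hrW, hrc⟩ := hr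
  have hmem : ∀ c, weave r g.1 c ∈ contGroup tf := weave_mem_contGroup fun x => by
    have hgx := mem_contGroup_iff.mp g.2 x
    rcases hg x with ⟨i, hi⟩ | h0
    · left
      filter_upwards [hgx, (hW i).isOpen.mem_nhds hi] with y hy hyW
      exact ⟨hrc i y hyW x hi, hy⟩
    · right
      rwa [h0] at hgx
  let φ : (X → ℤ) →+ ℤ := a.comp ((weave r g.1).codRestrict (contGroup tf) hmem)
  have h1 : φ 1 = a g := congrArg a (Subtype.ext (weave_one r g.1))
  rw [← h1]
  refine hX.map_eq_zero φ (fun y => ?_) 1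
  by_cases hy : ∃ i, ∃ x ∈ W i, r x = y
  · obtain ⟨i, x, hx, rfl⟩ := hy
    rw [← ha i]
    refine congrArg a (Subtype.ext ?_)
    change weave r g.1 (Pi.single (r x) 1) = _
    rw [weave_single, restrict_coe]
    ext z
    rcases hg z with ⟨j, hj⟩ | h0
    · have : z ∈ r ⁻¹' {r x} ↔ z ∈ W i := by
        constructor
        · intro hz
          have hz' : r z = r x := hz
          have : j = i := huniq (hrW j z hj) (hz' ▸ hrW i x hx)
          exact this ▸ hj
        · exact fun hz => hrc i z hz x hx
      simp only [Set.indicator, this]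
    · simp [Set.indicator, h0]
  · rw [← map_zero a]
    refine congrArg a (Subtype.ext ?_)
    change weave r g.1 (Pi.single y 1) = 0
    rw [weave_single]
    ext z
    rcases hg z with ⟨j, hj⟩ | h0
    · have : z ∉ r ⁻¹' {y} := fun hz => hy ⟨j, z, hj, hz⟩
      rw [Set.indicator_of_notMem this]; rfl
    · simp [Set.indicator, h0]

/-- Witnesses on the separate pieces glue to one function; weaving it turns `a` into a homomorphism
on ℤ^I, nonzero at each unit vector in question. -/
theorem IsClopenDecomposition.finite_nonzeroOn {tf : TopologicalSpace X} {I : Type v}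
    {U : I → Set X} (hU : IsClopenDecomposition tf U Set.univ) (a : contGroup tf →+ ℤ) :
    {i | NonzeroOn a (U i)}.Finite := by
  classical
  obtain ⟨hclopen, hdis, hcover⟩ := hU
  have hr : ∀ x, ∃ i, x ∈ U i := fun x => Set.mem_iUnion.mp (hcover ▸ Set.mem_univ x)
  choose r hr using hr
  have huniq : ∀ {i x}, x ∈ U i → r x = i := fun {i x} hi => by
    by_contra h
    exact Set.disjoint_left.mp (hdis _ _ h) (hr x) hi
  have hg : ∀ i, ∃ g : contGroup tf, Function.support g.1 ⊆ U i ∧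
      (NonzeroOn a (U i) → a g ≠ 0) := by
    intro i
    by_cases h : NonzeroOn a (U i)
    · obtain ⟨g, hg, hag⟩ := h
      exact ⟨g, hg, fun _ => hag⟩
    · exact ⟨0, by simp, fun h' => absurd h' h⟩
  choose g hg hag using hg
  have hmem : ∀ c, weave r (fun x => (g (r x)).1 x) c ∈ contGroup tf :=
    weave_mem_contGroup fun x => by
      left
      filter_upwards [mem_contGroup_iff.mp (g (r x)).2 x,
        (hclopen (r x)).isOpen.mem_nhds (hr x)] with y hy hyU
      rw [huniq hyU]
      exact ⟨rfl, hy⟩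
  refine (finite_map_single_ne_zero
    (a.comp ((weave r fun x => (g (r x)).1 x).codRestrict (contGroup tf) hmem))).subset ?_
  intro i hi
  have h := hag i hi
  rw [Set.mem_ofPred_eq]
  convert h using 1
  refine congrArg a (Subtype.ext ?_)
  change weave r _ (Pi.single i 1) = _
  rw [weave_single]
  ext x
  by_cases hx : r x = i
  · simp [Set.indicator, hx]
  · have : (g i).1 x = 0 := by
      by_contra h0
      exact hx (huniq (hg i h0))
    simp [Set.indicator, hx, this]

theorem IsClopenDecomposition.finitelyDetermined {tf : TopologicalSpace X}
    (hX : CountablyCompletePrincipal X) {I : Type v}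
    {U : I → Set X} (hU : IsClopenDecomposition tf U Set.univ) (a : contGroup tf →+ ℤ) :
    FinitelyDetermined a U := by
  have hvanish : ∀ g : contGroup tf,
      Function.support g.1 ⊆ (⋃ i ∈ {i | NonzeroOn a (U i)}, U i)ᶜ → a g = 0 := by
    intro g hg
    refine map_eq_zero_of_restrict hX hU.1 hU.2.1 a g
      (fun x => Or.inl (Set.mem_iUnion.mp (hU.2.2 ▸ Set.mem_univ x))) fun i => ?_
    by_cases hi : NonzeroOn a (U i)
    · have : restrict (hU.1 i) g = 0 := by
        refine Subtype.ext (Function.support_eq_empty_iff.mp ?_)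
        rw [support_restrict]
        refine Set.eq_empty_of_forall_notMem fun x hx => ?_
        exact hg hx.2 (Set.mem_biUnion (show i ∈ {i | NonzeroOn a (U i)} from hi) hx.1)
      rw [this, map_zero]
    · refine map_eq_zero_of_not_nonzeroOn hi ?_
      rw [support_restrict]; exact Set.inter_subset_left
  refine ⟨hU.finite_nonzeroOn a, fun g g' h => ?_, hvanish⟩
  rw [← sub_eq_zero, ← map_sub]
  refine hvanish _ fun x hx hx' => hx ?_
  obtain ⟨i, hi, hxi⟩ := Set.mem_iUnion₂.mp hx'
  exact sub_eq_zero.mpr (h i hi x hxi)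

/-- Every coarse neighbourhood contains one that is coarse-open and fine-clopen. -/
def HasFineClopenNhds (tc tf : TopologicalSpace X) : Prop :=
  ∀ x, ∀ N ∈ @nhds X tc x, ∃ V, IsOpen[tc] V ∧ @IsClopen X tf V ∧ x ∈ V ∧ V ⊆ N

theorem HasPointwiseDecompositions.hasFineClopenNhds {tc tf : TopologicalSpace X}
    (h : HasPointwiseDecompositions tc tf) : HasFineClopenNhds tc tf := by
  intro x N hN
  obtain ⟨I, W, -, hW⟩ := h x
  obtain ⟨J, h1, h2, h3⟩ := hW N hN
  exact ⟨_, h1, h2, Or.inl rfl, h3⟩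

/-! ### Localization of homomorphisms at points -/

section Points

variable {tf tc : TopologicalSpace X}

theorem exists_isOpen_not_nonzeroOn (hb : HasFineClopenNhds tc tf) {a : contGroup tf →+ ℤ}
    {x : X} (h : ¬ NonzeroNear tc a x) :
    ∃ V, IsOpen[tc] V ∧ @IsClopen X tf V ∧ x ∈ V ∧ ¬ NonzeroOn a V := by
  simp only [NonzeroNear, not_forall] at h
  obtain ⟨N, hN, hNa⟩ := h
  obtain ⟨V, h1, h2, h3, h4⟩ := hb x N hN
  exact ⟨V, h1, h2, h3, fun h => hNa (h.mono h4)⟩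

/-- Finitely many fine-clopen sets on which `a` is zero cover X. -/
theorem eq_zero_of_forall_not_nonzeroNear (hb : HasFineClopenNhds tc tf)
    (hcomp : @CompactSpace X tc) {a : contGroup tf →+ ℤ} (h : ∀ x, ¬ NonzeroNear tc a x) :
    a = 0 := by
  classical
  choose V hVo hVc hxV hVa using fun x => exists_isOpen_not_nonzeroOn hb (h x)
  obtain ⟨t, ht⟩ := (@isCompact_univ X tc hcomp).elim_finite_subcover V hVo
    fun x _ => Set.mem_iUnion.mpr ⟨x, hxV x⟩
  have key : ∀ s : Finset X, ¬ NonzeroOn a (⋃ x ∈ s, V x) := by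
    intro s
    induction s using Finset.induction_on with
    | empty =>
      rintro ⟨g, hg, ha⟩
      have : g = 0 := Subtype.ext (Function.support_eq_empty_iff.mp (by simpa using hg))
      exact ha (by rw [this, map_zero])
    | insert x s _ ih =>
      rw [Finset.set_biUnion_insert]
      exact not_nonzeroOn_union (hVc x) (hVa x) ih
  ext g
  exact map_eq_zero_of_not_nonzeroOn (key t) ((Set.subset_univ _).trans ht)

/-- Otherwise (D) yields a decomposition with `a` nonzero on infinitely many pieces. -/
theorem finite_nonzeroNear (hsep : HasSeparatingDecompositions tc tf) (a : contGroup tf →+ ℤ) :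
    {x | NonzeroNear tc a x}.Finite := by
  by_contra hinf
  obtain ⟨I, U, hU, hI⟩ := hsep _ hinf
  refine hI ((hU.finite_nonzeroOn a).subset ?_)
  rintro i ⟨x, hx, hxi⟩
  exact hx _ (mem_interior_iff_mem_nhds.mp hxi)

theorem NonzeroNear.of_comp_restrict {a : contGroup tf →+ ℤ} {V : Set X}
    {hV : @IsClopen X tf V} {x : X} (h : NonzeroNear tc (a.comp (restrict hV)) x) :
    NonzeroNear tc a x := by
  intro N hN
  obtain ⟨g, hg, ha⟩ := h N hN
  refine ⟨restrict hV g, ?_, ha⟩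
  rw [support_restrict]
  exact Set.inter_subset_right.trans hg

theorem not_nonzeroNear_comp_restrict {a : contGroup tf →+ ℤ} {V N : Set X}
    {hV : @IsClopen X tf V} {x : X} (hN : N ∈ @nhds X tc x) (hVN : Disjoint V N) :
    ¬ NonzeroNear tc (a.comp (restrict hV)) x := by
  intro h
  obtain ⟨g, hg, ha⟩ := h N hN
  have : restrict hV g = 0 := by
    refine Subtype.ext (Function.support_eq_empty_iff.mp ?_)
    rw [support_restrict]
    exact (hVN.mono_right hg).inter_eq
  exact ha (by rw [AddMonoidHom.comp_apply, this, map_zero])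

theorem NonzeroNear.comp_restrict {a : contGroup tf →+ ℤ} {V : Set X}
    {hV : @IsClopen X tf V} {x : X} (h : NonzeroNear tc a x) (hx : V ∈ @nhds X tc x) :
    NonzeroNear tc (a.comp (restrict hV)) x := by
  intro N hN
  obtain ⟨g, hg, ha⟩ := h _ (Filter.inter_mem hN hx)
  refine ⟨g, hg.trans Set.inter_subset_left, ?_⟩
  have : restrict hV g = g :=
    Subtype.ext (Set.indicator_eq_self.mpr (hg.trans Set.inter_subset_right))
  rwa [AddMonoidHom.comp_apply, this]

/-- The summands restrict `a` to disjoint neighbourhoods of the points of `s`. The difference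
between `a` and their sum is nonzero near no point, hence zero. -/
theorem exists_sum_of_nonzeroNear (hc : @T2Space X tc) (hb : HasFineClopenNhds tc tf)
    (hcomp : @CompactSpace X tc) (s : Finset X) (a : contGroup tf →+ ℤ)
    (hs : ∀ x, NonzeroNear tc a x ↔ x ∈ s) :
    ∃ b : s → (contGroup tf →+ ℤ), a = ∑ x, b x ∧ ∀ x, UniquelyNonzeroNear tc (b x) x := by
  classical
  obtain ⟨N, hN, hNdis⟩ := s.finite_toSet.t2_separation
  choose V hVo hVc hxV hVN using fun x => hb x (N x) ((hN x).2.mem_nhds (hN x).1)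
  have hdis : ∀ x ∈ s, ∀ y ∈ s, x ≠ y → Disjoint (V x) (V y) := fun x hx y hy hxy =>
    (hNdis hx hy hxy).mono (hVN x) (hVN y)
  refine ⟨fun x => a.comp (restrict (hVc x)), ?_, fun x => ⟨?_, fun y hy => ?_⟩⟩
  · rw [← sub_eq_zero]
    refine eq_zero_of_forall_not_nonzeroNear hb hcomp fun y hy => ?_
    have hval : ∀ g, (a - ∑ x : s, a.comp (restrict (hVc x))) g
        = a (g - ∑ x : s, restrict (hVc x) g) := by
      intro g
      simp [AddMonoidHom.sub_apply, AddMonoidHom.finsetSum_apply]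
    by_cases hys : y ∈ s
    · obtain ⟨g, hg, ha⟩ := hy (V y) ((hVo y).mem_nhds (hxV y))
      rw [hval, Finset.sum_eq_single ⟨y, hys⟩] at ha
      · have : restrict (hVc y) g = g := Subtype.ext (Set.indicator_eq_self.mpr hg)
        rw [this, sub_self, map_zero] at ha
        exact ha rfl
      · intro x _ hxy
        refine Subtype.ext (Function.support_eq_empty_iff.mp ?_)
        rw [support_restrict]
        exact ((hdis x x.2 y hys fun h => hxy (Subtype.ext h)).mono_right hg).inter_eq
      · exact fun h => absurd (Finset.mem_univ _) h
    · obtain ⟨M, hMo, -, hyM, hMa⟩ := exists_isOpen_not_nonzeroOn hb (mt (hs y).mp hys)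
      obtain ⟨g, hg, ha⟩ := hy M (hMo.mem_nhds hyM)
      rw [hval, map_sub, map_sum, map_eq_zero_of_not_nonzeroOn hMa hg, Finset.sum_eq_zero] at ha
      · exact ha (sub_zero 0)
      · intro x _
        refine map_eq_zero_of_not_nonzeroOn hMa ?_
        rw [support_restrict]
        exact Set.inter_subset_right.trans hg
  · exact ((hs x).mpr x.2).comp_restrict ((hVo x).mem_nhds (hxV x))
  · by_contra hyx
    have hys := (hs y).mp hy.of_comp_restrict
    exact not_nonzeroNear_comp_restrict ((hVo y).mem_nhds (hxV y))
      (hdis x x.2 y hys (Ne.symm hyx)) hy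

theorem UniquelyNonzeroNear.ne_zero {a : contGroup tf →+ ℤ} {x : X}
    (h : UniquelyNonzeroNear tc a x) : a ≠ 0 := by
  rintro rfl
  obtain ⟨g, -, hg⟩ := h.1 Set.univ Filter.univ_mem
  exact hg rfl

theorem UniquelyNonzeroNear.map_eq_zero (hb : HasFineClopenNhds tc tf)
    (hcomp : @CompactSpace X tc) {a : contGroup tf →+ ℤ} {x : X}
    (h : UniquelyNonzeroNear tc a x) {g : contGroup tf}
    (hg : x ∉ closure[tc] (Function.support g.1)) : a g = 0 := by
  obtain ⟨V, hVo, hVc, hxV, hV⟩ := hb x _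
    ((@isClosed_closure X tc _).isOpen_compl.mem_nhds hg)
  -- Cutting away a neighbourhood of `x` leaves no point near which the homomorphism is nonzero.
  have h0 : a.comp (restrict (@IsClopen.compl X tf V hVc)) = 0 := by
    refine eq_zero_of_forall_not_nonzeroNear hb hcomp fun y hy => ?_
    obtain rfl := h.2 y hy.of_comp_restrict
    exact not_nonzeroNear_comp_restrict (hVo.mem_nhds hxV) disjoint_compl_left hy
  have hgV : restrict (@IsClopen.compl X tf V hVc) g = g := by
    refine Subtype.ext (Set.indicator_eq_self.mpr fun y hy hyV => ?_)
    exact hV hyV (@subset_closure X tc _ _ hy)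
  have := DFunLike.congr_fun h0 g
  rwa [AddMonoidHom.comp_apply, hgV] at this

theorem uniquelyNonzeroNear_iff (hc : @T2Space X tc) (hb : HasFineClopenNhds tc tf)
    (hcomp : @CompactSpace X tc) (a : contGroup tf →+ ℤ) (x : X) :
    UniquelyNonzeroNear tc a x ↔
      (a ≠ 0 ∧ ∀ g : contGroup tf, x ∉ closure[tc] (Function.support g.1) → a g = 0) := by
  refine ⟨fun h => ⟨h.ne_zero, fun g => h.map_eq_zero hb hcomp⟩, fun ⟨h0, h⟩ => ?_⟩
  have huniq : ∀ y, NonzeroNear tc a y → y = x := by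
    intro y hy
    by_contra hyx
    obtain ⟨P, Q, hP, hQ, hyP, hxQ, hPQ⟩ := t2_separation hyx
    obtain ⟨g, hg, ha⟩ := hy P (hP.mem_nhds hyP)
    refine ha (h g fun hx => ?_)
    exact Set.disjoint_left.mp (hPQ.closure_left hQ) (closure_mono hg hx) hxQ
  obtain ⟨y, hy⟩ : ∃ y, NonzeroNear tc a y := by
    by_contra! hn
    exact h0 (eq_zero_of_forall_not_nonzeroNear hb hcomp hn)
  obtain rfl := huniq y hy
  exact ⟨hy, huniq⟩

theorem UniquelyNonzeroNear.map_eq_zero_of_apply_eq_zero (hX : CountablyCompletePrincipal X)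
    (hc : @T2Space X tc) (hcomp : @CompactSpace X tc) (hp : HasPointwiseDecompositions tc tf)
    {a : contGroup tf →+ ℤ} {x : X} (h : UniquelyNonzeroNear tc a x) {g : contGroup tf}
    (hg : g.1 x = 0) : a g = 0 := by
  obtain ⟨I, W, ⟨hW, hdis, hcover⟩, hnhds⟩ := hp x
  refine map_eq_zero_of_restrict hX hW hdis a g (fun y => ?_) fun i => ?_
  · by_cases hyx : y = x
    · right; rw [hyx, hg]
    · left
      exact Set.mem_iUnion.mp (hcover ▸ (hyx : y ∈ ({x}ᶜ : Set X)))
  · refine h.map_eq_zero hp.hasFineClopenNhds hcomp ?_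
    rw [support_restrict]
    intro hx
    have hxW : x ∉ W i := fun hxi =>
      (hcover ▸ Set.mem_iUnion.mpr ⟨i, hxi⟩ : x ∈ ({x}ᶜ : Set X)) rfl
    obtain ⟨y, hy⟩ : (W i).Nonempty := by
      rw [Set.nonempty_iff_ne_empty]
      intro he
      simp [he] at hx
    have hyx : x ≠ y := fun e => hxW (e ▸ hy)
    -- A basic neighbourhood of `x` that misses one point of `W i` misses all of it, so `x` is not
    -- in the closure of `W i`.
    obtain ⟨J, hJo, -, hJN⟩ := hnhds _ (isOpen_compl_singleton.mem_nhds hyx)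
    have hiJ : i ∉ J := fun hi => hJN (Or.inr (Set.mem_biUnion hi hy)) rfl
    obtain ⟨z, hz, hzW, -⟩ := mem_closure_iff.mp hx _ hJo (Or.inl rfl)
    rcases hz with hzx | hz
    · exact hxW ((Set.mem_singleton_iff.mp hzx) ▸ hzW)
    · obtain ⟨j, hj, hzj⟩ := Set.mem_iUnion₂.mp hz
      exact Set.disjoint_left.mp (hdis j i fun e => hiJ (e ▸ hj)) hzj hzW

theorem UniquelyNonzeroNear.exists_eq_zsmul (hX : CountablyCompletePrincipal X)
    (hc : @T2Space X tc) (hcomp : @CompactSpace X tc) (hp : HasPointwiseDecompositions tc tf)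
    {a : contGroup tf →+ ℤ} {x : X} (h : UniquelyNonzeroNear tc a x) :
    ∃ n : ℤ, a = n • evalHom tf x := by
  let e : contGroup tf := ⟨1, mem_contGroup_iff.mpr fun _ => Filter.Eventually.of_forall
    fun _ => rfl⟩
  refine ⟨a e, ?_⟩
  ext g
  -- Subtracting the constant `g.1 x` makes the function vanish at `x`.
  have h0 : a (g - g.1 x • e) = 0 := h.map_eq_zero_of_apply_eq_zero hX hc hcomp hp (by
    change g.1 x - g.1 x • (1 : X → ℤ) x = 0
    simp)
  rw [map_sub, map_zsmul, sub_eq_zero] at h0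
  rw [h0, AddMonoidHom.smul_apply, smul_eq_mul, smul_eq_mul, mul_comm]
  rfl

theorem linearIndependent_evalHom (hc : @T2Space X tc) (hb : HasFineClopenNhds tc tf) :
    LinearIndependent ℤ (evalHom tf) := by
  classical
  rw [linearIndependent_iff']
  intro s c hsum x hx
  have hN : ((s.erase x : Finset X) : Set X)ᶜ ∈ @nhds X tc x :=
    (s.erase x).finite_toSet.isClosed.isOpen_compl.mem_nhds (by simp)
  -- The indicator of `V` is 1 at `x` and 0 at the other points of `s`, so it isolates `c x`.
  obtain ⟨V, -, hVc, hxV, hVN⟩ := hb x _ hN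
  let e : contGroup tf := ⟨1, mem_contGroup_iff.mpr fun _ => Filter.Eventually.of_forall
    fun _ => rfl⟩
  have h := DFunLike.congr_fun hsum (restrict hVc e)
  rw [AddMonoidHom.finsetSum_apply, Finset.sum_eq_single x] at h
  · have h1 : evalHom tf x (restrict hVc e) = 1 := Set.indicator_of_mem hxV _
    rwa [AddMonoidHom.smul_apply, h1, smul_eq_mul, mul_one] at h
  · intro y hy hyx
    have h1 : evalHom tf y (restrict hVc e) = 0 :=
      Set.indicator_of_notMem (fun hyV => hVN hyV (by simp [hy, hyx])) _
    rw [AddMonoidHom.smul_apply, h1, smul_zero]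
  · exact fun h => absurd hx h

end Points

end TwoTopologies

theorem corollary5p2 {X : Type u} (tc tf : TopologicalSpace X)
    (hc : @T2Space X tc) (hf : @T2Space X tf)
    (hsep : HasSeparatingDecompositions tc tf) :
    -- the weakened hypotheses
    (@CompactSpace X tc →
      (∀ κ : Cardinal.{u}, IsMeasurableCardinal κ → Cardinal.mk X < κ) →
      HasPointwiseDecompositions tc tf →
        -- the evaluation maps are linearly independent
        LinearIndependent ℤ (evalHom tf) ∧
        -- a nonzero homomorphism is nonzero near some point
        (∀ a : contGroup tf →+ ℤ, a ≠ 0 → ∃ x, NonzeroNear tc a x) ∧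
        -- decompositions into fine-clopen sets, with no countability assumption
        (∀ (I : Type v) (U : I → Set X), IsClopenDecomposition tf U Set.univ →
          ∀ a : contGroup tf →+ ℤ, FinitelyDetermined a U) ∧
        -- a homomorphism is nonzero near only finitely many points
        (∀ a : contGroup tf →+ ℤ, {x | NonzeroNear tc a x}.Finite) ∧
        -- decomposition into homomorphisms concentrated at single points
        (∀ a : contGroup tf →+ ℤ, ∃ (n : ℕ) (b : Fin n → (contGroup tf →+ ℤ)),
          a = ∑ m, b m ∧ ∀ m, ∃ x, UniquelyNonzeroNear tc (b m) x) ∧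
        -- the equivalent description of being concentrated at a point
        (∀ (a : contGroup tf →+ ℤ) (x : X), UniquelyNonzeroNear tc a x ↔
          (a ≠ 0 ∧ ∀ g : contGroup tf, x ∉ closure[tc] (Function.support g.1) → a g = 0)) ∧
        -- homomorphisms concentrated at a point are multiples of evaluation there
        (∀ (a : contGroup tf →+ ℤ) (x : X), UniquelyNonzeroNear tc a x →
          ∃ n : ℤ, a = n • evalHom tf x) ∧
        -- the dual is free abelian on the evaluation maps
        (∃ b : Module.Basis X ℤ (contGroup tf →+ ℤ), ∀ x, b x = evalHom tf x)) ∧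
    -- the original hypotheses
    (@CompactSpace X tc → @FirstCountableTopology X tc → HasFineClopenBasis tc tf →
      ∀ (I : Type v) (U : I → Set X), IsClopenDecomposition tf U Set.univ →
        ∀ a : contGroup tf →+ ℤ, FinitelyDetermined a U) := by
  constructor
  · intro hcomp hcard hp
    have hX := countablyCompletePrincipal_of_lt_measurable hcard
    have hb := hp.hasFineClopenNhds
    have hdecomp : ∀ a : contGroup tf →+ ℤ, ∃ (n : ℕ) (b : Fin n → (contGroup tf →+ ℤ)),
        a = ∑ m, b m ∧ ∀ m, ∃ x, UniquelyNonzeroNear tc (b m) x := by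
      intro a
      obtain ⟨b, hab, hbu⟩ := exists_sum_of_nonzeroNear hc hb hcomp
        (finite_nonzeroNear hsep a).toFinset a fun x => by simp
      let e := (finite_nonzeroNear hsep a).toFinset.equivFin
      exact ⟨_, b ∘ e.symm, hab.trans (e.symm.sum_comp b).symm, fun m => ⟨_, hbu (e.symm m)⟩⟩
    have hmul : ∀ (a : contGroup tf →+ ℤ) (x : X), UniquelyNonzeroNear tc a x →
        ∃ n : ℤ, a = n • evalHom tf x := fun a x h => h.exists_eq_zsmul hX hc hcomp hp
    have hli := linearIndependent_evalHom hc hb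
    refine ⟨hli, ?_, fun I U hU a => hU.finitelyDetermined hX a, finite_nonzeroNear hsep, hdecomp,
      uniquelyNonzeroNear_iff hc hb hcomp, hmul, ?_⟩
    · intro a ha
      by_contra! hn
      exact ha (eq_zero_of_forall_not_nonzeroNear hb hcomp hn)
    · refine ⟨Module.Basis.mk hli fun a _ => ?_, fun x => Module.Basis.mk_apply _ _ x⟩
      obtain ⟨n, b, rfl, hbu⟩ := hdecomp a
      refine Submodule.sum_mem _ fun m _ => ?_
      obtain ⟨x, hx⟩ := hbu m
      obtain ⟨k, hk⟩ := hmul _ x hx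
      rw [hk]
      exact Submodule.smul_mem _ _ (Submodule.subset_span ⟨x, rfl⟩)
  · intro hcomp hfirst _ I U hU a
    exact hU.finitelyDetermined
      (@countablyCompletePrincipal_of_compact_firstCountable X tc hc hcomp hfirst) a
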